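/- For $\alpha,\beta>0$ and $\theta\in[0,2\pi)$ let $H_{\alpha,\beta,\theta}$ be the almost Mathieu operator on $\ell^2(\mathbb Z)$, $$(H_{\alpha,\beta,\theta}f)(x)=f(x+1)+f(x-1)+2\beta\cos(2\pi\alpha x+\theta)\,f(x),\qquad x\in\mathbb Z.$$ For $\gamma>0$ and an integer $m\ge 0$ with parity $r\in\{0,1\}$ (so $r\equiv m \bmod 2$), let $\varphi_m$ be the scaled Hermite function $$\varphi_m(x)=e^{-\gamma x^2}\sum_{l=0}^{(m-r)/2}(\sqrt\gamma)^{2l+r}c_{m,l}\,x^{2l+r},\qquad c_{m,l}=\frac{m!\,(2\sqrt2)^{2l+r}(-1)^{\frac{m-r}{2}-l}}{(2l+r)!\,\left(\frac{m-r}{2}-l\right)!},$$ and let $\lambda_m=2\beta+2e^{-\gamma}-4m\gamma e^{-\gamma}$. Then the following hold. 1. (Approximate eigenvectors.) For every $N\in\mathbb N$ there is a constant $C=C(N)>0$ such that, for all $0\le m\le N$, all $\alpha,\beta>0$ for which $\gamma=\pi\alpha\sqrt\beta$ satisfies $\gamma<1$, and all $\theta\in[0,2\pi)$, the translate $\psi_m(x)=\varphi_m\!\left(x+\frac{\theta}{2\pi\alpha}\right)$,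 $x\in\mathbb Z$ (which is $\varphi_m$ itself when $\theta=0$), belongs to $\ell^2(\mathbb Z)$ and $$\left|(H_{\alpha,\beta,\theta}\psi_m)(x)-\lambda_m\psi_m(x)\right|\le C\left(1+\frac1\beta\right)\gamma^2\qquad\text{for all }x\in\mathbb Z .$$ In particular, for fixed $\beta$ and $m=O(1)$ the error is $O(\gamma^2)$. 2. (Exponential decay.) For each $m\ge 0$ and $0<\gamma<1$ there exist constants $C_1,C_2>0$ such that $|\varphi_m(i)|\le C_1e^{-C_2|i|}$ for all $i\in\mathbb Z$. 3. (Sign changes.) For all $0<\gamma<1$ and all integers $0\le m<\frac{\pi^2}{4\gamma}-\frac12$, the sequence $(\varphi_m(i))_{i\in\mathbb Z}$ changes sign exactly $m$ times (zero entries being disregarded). -/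

import Mathlib

open scoped Nat

noncomputable section

/-- The coefficients `c_{m,l}` of the scaled Hermite functions, both parities at once:
`m % 2` is the parity of `m`, `m / 2` (natural division) is `m/2` for even `m` and `(m-1)/2` for
odd `m`, and only `l ≤ m / 2` is used. -/
def hermiteCoeff (m l : ℕ) : ℝ :=
  ((m ! : ℕ) : ℝ) * (2 * √2) ^ (2 * l + m % 2) * (-1) ^ (m / 2 - l) /
    ((((2 * l + m % 2)! : ℕ) : ℝ) * (((m / 2 - l)! : ℕ) : ℝ))

/-- The scaled Hermite function `φ_m` with parameter `γ`, given by its formula at every real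
argument. The sequence on `ℤ` is its restriction; non-integer arguments occur only in translates
by a real number. -/
def scaledHermite (γ : ℝ) (m : ℕ) (x : ℝ) : ℝ :=
  Real.exp (-γ * x ^ 2) *
    ∑ l ∈ Finset.range (m / 2 + 1),
      √γ ^ (2 * l + m % 2) * hermiteCoeff m l * x ^ (2 * l + m % 2)

/-- `(H_{α,β,θ} f)(x) = f (x + 1) + f (x - 1) + 2 β cos (2 π α x + θ) f x`, on sequences. -/
def almostMathieuFun (α β θ : ℝ) (f : ℤ → ℂ) (x : ℤ) : ℂ :=
  f (x + 1) + f (x - 1) + ((2 * β * Real.cos (2 * Real.pi * α * x + θ) : ℝ) : ℂ) * f x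

/-- Square summability is invariant under integer translation. -/
theorem memℓp_two_translate {f : ℤ → ℂ} (hf : Memℓp f 2) (a : ℤ) :
    Memℓp (fun x => f (x + a)) 2 := by
  have h2 : 0 < (2 : ENNReal).toReal := by norm_num
  rw [memℓp_gen_iff h2] at hf ⊢
  exact hf.comp_injective (add_left_injective a)

/-- The formula maps `ℓ²(ℤ)` to itself. -/
theorem memℓp_two_almostMathieuFun (α β θ : ℝ) {f : ℤ → ℂ} (hf : Memℓp f 2) :
    Memℓp (almostMathieuFun α β θ f) 2 := by
  have h1 := memℓp_two_translate hf 1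
  have h2 := memℓp_two_translate hf (-1)
  have h3 : Memℓp
      (fun x : ℤ => ((2 * β * Real.cos (2 * Real.pi * α * x + θ) : ℝ) : ℂ) * f x) 2 := by
    have hp : 0 < (2 : ENNReal).toReal := by norm_num
    have hf' := hf.const_mul ((2 * β : ℝ) : ℂ)
    rw [memℓp_gen_iff hp] at hf' ⊢
    refine Summable.of_nonneg_of_le (fun _ => by positivity) (fun x => ?_) hf'
    refine Real.rpow_le_rpow (norm_nonneg _) ?_ hp.le
    rw [norm_mul, norm_mul, Complex.norm_real, Complex.norm_real, Real.norm_eq_abs,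
      Real.norm_eq_abs]
    have hc := Real.abs_cos_le_one (2 * Real.pi * α * x + θ)
    rw [abs_mul]
    refine mul_le_mul_of_nonneg_right ?_ (norm_nonneg _)
    exact mul_le_of_le_one_right (abs_nonneg _) hc
  exact (h1.add h2).add h3

/-- The almost Mathieu operator `H_{α,β,θ}` on `ℓ²(ℤ)`. -/
def almostMathieu (α β θ : ℝ) :
    lp (fun _ : ℤ => ℂ) 2 →ₗ[ℂ] lp (fun _ : ℤ => ℂ) 2 where
  toFun f := ⟨almostMathieuFun α β θ f, memℓp_two_almostMathieuFun α β θ (lp.memℓp f)⟩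
  map_add' f g := by
    ext x
    change almostMathieuFun α β θ (⇑f + ⇑g) x =
      almostMathieuFun α β θ f x + almostMathieuFun α β θ g x
    simp only [almostMathieuFun, Pi.add_apply]
    ring
  map_smul' c f := by
    ext x
    change almostMathieuFun α β θ (c • ⇑f) x = c * almostMathieuFun α β θ f x
    simp only [almostMathieuFun, Pi.smul_apply, smul_eq_mul]
    ring

/-- The approximate eigenvalue `λ_m = 2 β + 2 e^{-γ} - 4 m γ e^{-γ}`. -/
def approxEigenvalue (β γ : ℝ) (m : ℕ) : ℝ :=
  2 * β + 2 * Real.exp (-γ) - 4 * m * γ * Real.exp (-γ)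

/-- The number of sign changes of a two-sided real sequence: the number of pairs of nonzero entries
of opposite sign with no nonzero entry between them (zero entries are disregarded). -/
def signChanges (f : ℤ → ℝ) : ℕ∞ :=
  {p : ℤ × ℤ | p.1 < p.2 ∧ f p.1 * f p.2 < 0 ∧
    ∀ k : ℤ, p.1 < k → k < p.2 → f k = 0}.encard

end

open Polynomial

/-! Put y = 2√γ x. Then φ_m(x) = √2^m g(y), where g(y) = exp(-y²/4) He_m(y) solves the oscillator
equation g'' = (y²/4 - m - 1/2) g (`gaussPoly_realHermite_second_derivative`). A unit step in x is a
step 2√γ in y, so the hopping terms give 2g + 4γ g'' up to O(γ²), and the cosine term gives 2β g - γ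
y² g up to O(γ²/β). The y² terms cancel, and the remaining factor 2β + 2 - (4m + 2)γ equals λ_m up
to O(γ²).

Decay comes from the Gaussian. For the sign changes, He_m has m simple real zeros, and Sturm
comparison with u'' = -(m + 1/2) u keeps consecutive zeros at least π/√(m + 1/2) apart
(`realHermite.pi_le_of_consecutive_roots`). The bound on m says that this exceeds the mesh 2√γ, so
lattice points separate the zeros and each zero yields one sign change
(`signChanges_eq_card_roots`). -/

/-! ### Hermite polynomials: recurrences and simple real zeros -/

theorem Polynomial.derivative_hermite_succ (n : ℕ) :
    derivative (hermite (n + 1)) = (n + 1 : ℤ[X]) * hermite n := by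
  induction n with
  | zero => simp
  | succ n ih =>
    have h := hermite_succ n
    rw [hermite_succ (n + 1), derivative_sub, derivative_mul, derivative_X, ih, derivative_mul]
    simp only [derivative_add, derivative_natCast, derivative_one]
    push_cast
    rw [h]
    ring

/-- The probabilists' Hermite polynomials with real coefficients. -/
noncomputable def realHermite (m : ℕ) : Polynomial ℝ :=
  (Polynomial.hermite m).map (Int.castRingHom ℝ)

namespace realHermite

theorem zero : realHermite 0 = 1 := by simp [realHermite]

theorem succ (m : ℕ) : realHermite (m + 1) = X * realHermite m - derivative (realHermite m) := by
  simp [realHermite, derivative_map]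

theorem derivative_succ (m : ℕ) :
    derivative (realHermite (m + 1)) = (m + 1 : ℝ[X]) * realHermite m := by
  rw [realHermite, derivative_map, derivative_hermite_succ]
  simp [realHermite]

theorem monic (m : ℕ) : (realHermite m).Monic := (hermite_monic m).map _

theorem natDegree (m : ℕ) : (realHermite m).natDegree = m := by
  rw [realHermite, (hermite_monic m).natDegree_map, natDegree_hermite]

theorem differential_equation (m : ℕ) :
    derivative (derivative (realHermite m)) =
      X * derivative (realHermite m) - (m : ℝ[X]) * realHermite m := by
  have h := congrArg derivative (succ m)
  rw [derivative_succ, derivative_sub, derivative_mul, derivative_X] at h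
  linear_combination h

/-- The three-term recurrence would carry a common zero of two consecutive polynomials down to He_0
= 1. -/
theorem eval_ne_zero_of_eval_succ_eq_zero (m : ℕ) (x : ℝ)
    (h : (realHermite (m + 1)).eval x = 0) : (realHermite m).eval x ≠ 0 := by
  induction m with
  | zero => simp [zero]
  | succ m ih =>
    intro h0
    have h1 := congrArg (eval x) (succ (m + 1))
    rw [derivative_succ] at h1
    simp only [eval_sub, eval_mul, h, h0, eval_add, eval_natCast, eval_one, mul_zero, zero_sub]
      at h1
    have h2 : (realHermite m).eval x = 0 := by
      have : (m : ℝ) + 1 ≠ 0 := by positivity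
      have h3 : ((m : ℝ) + 1) * (realHermite m).eval x = 0 := by linarith
      exact (mul_eq_zero.mp h3).resolve_left this
    exact ih h0 h2

theorem eval_derivative_ne_zero (m : ℕ) (x : ℝ) (h : (realHermite m).eval x = 0) :
    (derivative (realHermite m)).eval x ≠ 0 := by
  cases m with
  | zero => simp [zero] at h
  | succ m =>
    rw [derivative_succ]
    have h1 := eval_ne_zero_of_eval_succ_eq_zero m x h
    have h2 : (m : ℝ) + 1 ≠ 0 := by positivity
    simp [h1, h2]

end realHermite

/-- If all roots of `p` are real then so are all roots of `X * p - p'`. -/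
theorem Polynomial.Splits.X_mul_sub_derivative {p : ℝ[X]} (hp : p.Splits) :
    (X * p - derivative p).Splits := by
  refine Splits.of_splits_map Complex.ofRealHom (IsAlgClosed.splits _) fun z hz => ?_
  suffices hz0 : z.im = 0 from ⟨z.re, Complex.ext (by simp) (by simp [hz0])⟩
  by_contra him
  set q : ℂ[X] := p.map Complex.ofRealHom with hq
  have hqs : q.Splits := hp.map _
  have hroots : ∀ w ∈ q.roots, w.im = 0 := by
    rw [hp.roots_map]
    intro w hw
    obtain ⟨t, -, rfl⟩ := Multiset.mem_map.mp hw
    simp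
  have hq0 : q.eval z ≠ 0 := by
    intro h0
    by_cases hqz : q = 0
    · have : p = 0 := (Polynomial.map_eq_zero _).mp hqz
      simp [this] at hz
    · exact him (hroots z ((mem_roots hqz).mpr h0))
  have hmain := hqs.eval_derivative_div_eval_of_ne_zero hq0
  have hev : z * q.eval z - (derivative q).eval z = 0 := by
    have h1 := (mem_roots'.mp hz).2
    simpa [IsRoot, hq, derivative_map] using h1
  have hdiv : (derivative q).eval z / q.eval z = z := by
    rw [div_eq_iff hq0]; linear_combination -hev
  rw [hdiv] at hmain
  -- For real w, 1/(z - w) has imaginary part of sign opposite to that of z. The sum over the roots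
  -- is q'(z)/q(z) = z, which forces (Im z)² ≤ 0.
  have key : ∀ s : Multiset ℂ, (∀ w ∈ s, w.im = 0) →
      z.im * ((s.map fun w => 1 / (z - w)).sum).im ≤ 0 := by
    intro s
    induction s using Multiset.induction_on with
    | empty => simp
    | cons a s ih =>
      intro hs
      have ha := hs a (by simp)
      have h1 := ih fun w hw => hs w (by simp [hw])
      have h2 : z.im * (1 / (z - a)).im ≤ 0 := by
        rw [one_div, Complex.inv_im, Complex.sub_im, ha, sub_zero, ← mul_div_assoc]
        exact div_nonpos_of_nonpos_of_nonneg (by nlinarith [mul_self_nonneg z.im])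
          (Complex.normSq_nonneg _)
      rw [Multiset.map_cons, Multiset.sum_cons, Complex.add_im, mul_add]
      linarith
  have h := key _ hroots
  rw [← hmain] at h
  exact him (by nlinarith [mul_self_nonneg z.im] : z.im = 0)

namespace realHermite

theorem splits (m : ℕ) : (realHermite m).Splits := by
  induction m with
  | zero => rw [zero]; exact Splits.one
  | succ m ih => rw [succ]; exact ih.X_mul_sub_derivative

theorem nodup_roots (m : ℕ) : (realHermite m).roots.Nodup := by
  rw [Multiset.nodup_iff_count_le_one]
  intro x
  rw [count_roots]
  by_contra! h
  have h1 := (one_lt_rootMultiplicity_iff_isRoot (monic m).ne_zero).mp h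
  exact eval_derivative_ne_zero m x h1.1 h1.2

theorem card_roots_toFinset (m : ℕ) : (realHermite m).roots.toFinset.card = m := by
  rw [Multiset.toFinset_card_of_nodup (nodup_roots m), ← (splits m).natDegree_eq_card_roots,
    natDegree]

end realHermite

/-! ### Gaussian times polynomial, and decay of φ_m -/

/-- The product of the Gaussian `exp (-y ^ 2 / 4)` and a polynomial. -/
noncomputable def gaussPoly (p : ℝ[X]) (y : ℝ) : ℝ := Real.exp (-y ^ 2 / 4) * p.eval y

/-- The polynomial factor of the derivative of `gaussPoly p`. -/
noncomputable def gaussPolyDeriv (p : ℝ[X]) : ℝ[X] := derivative p - C (1 / 2) * (X * p)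

theorem hasDerivAt_gaussPoly (p : ℝ[X]) (y : ℝ) :
    HasDerivAt (gaussPoly p) (gaussPoly (gaussPolyDeriv p) y) y := by
  have h1 : HasDerivAt (fun y : ℝ => Real.exp (-y ^ 2 / 4))
      (Real.exp (-y ^ 2 / 4) * (-(2 * y) / 4)) y := by
    have := (((hasDerivAt_pow 2 y).neg).div_const 4).exp
    simpa using this
  have h2 := h1.mul (p.hasDerivAt y)
  refine h2.congr_deriv ?_
  simp only [gaussPoly, gaussPolyDeriv, eval_sub, eval_mul, eval_C, eval_X]
  ring

theorem exists_abs_exp_mul_eval_le {c : ℝ} (hc : 0 < c) (p : ℝ[X]) :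
    ∃ B : ℝ, 0 < B ∧ ∀ x : ℝ, |Real.exp (-c * x ^ 2) * p.eval x| ≤ B := by
  induction p using Polynomial.induction_on' with
  | add p q hp hq =>
    obtain ⟨B, hB, h⟩ := hp
    obtain ⟨B', hB', h'⟩ := hq
    refine ⟨B + B', by positivity, fun x => ?_⟩
    rw [eval_add, mul_add]
    exact (abs_add_le _ _).trans (add_le_add (h x) (h' x))
  | monomial n a =>
    refine ⟨(|a| + 1) * (1 + (n ! : ℝ) / c ^ n), by positivity, fun x => ?_⟩
    have h1 : (c * x ^ 2) ^ n / (n ! : ℝ) ≤ Real.exp (c * x ^ 2) :=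
      Real.pow_div_factorial_le_exp _ (by positivity) n
    -- Passing to even powers lets one term of the series of exp(c x²) dominate.
    have h2 : |x| ^ n ≤ 1 + (x ^ 2) ^ n := by
      rw [← sq_abs, ← pow_mul, mul_comm 2 n, pow_mul]
      nlinarith [sq_nonneg (|x| ^ n - 1), pow_nonneg (abs_nonneg x) n]
    have hn : (0 : ℝ) < (n ! : ℝ) := by exact_mod_cast n.factorial_pos
    have h3 : (x ^ 2) ^ n ≤ (n ! : ℝ) / c ^ n * Real.exp (c * x ^ 2) := by
      rw [mul_pow, div_le_iff₀ hn] at h1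
      rw [div_mul_eq_mul_div, le_div_iff₀ (by positivity)]
      linarith
    have h4 : Real.exp (-c * x ^ 2) * Real.exp (c * x ^ 2) = 1 := by
      rw [← Real.exp_add]; simp
    have h5 : Real.exp (-c * x ^ 2) ≤ 1 := by
      rw [Real.exp_le_one_iff]; nlinarith [sq_nonneg x]
    have hE := Real.exp_pos (-c * x ^ 2)
    rw [eval_monomial, abs_mul, abs_mul, abs_pow, Real.abs_exp]
    calc Real.exp (-c * x ^ 2) * (|a| * |x| ^ n)
        = |a| * (Real.exp (-c * x ^ 2) * |x| ^ n) := by ring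
      _ ≤ |a| * (Real.exp (-c * x ^ 2) * (1 + (n ! : ℝ) / c ^ n * Real.exp (c * x ^ 2))) := by
        gcongr; linarith
      _ = |a| * (Real.exp (-c * x ^ 2) + (n ! : ℝ) / c ^ n *
            (Real.exp (-c * x ^ 2) * Real.exp (c * x ^ 2))) := by ring
      _ ≤ (|a| + 1) * (1 + (n ! : ℝ) / c ^ n) := by
        rw [h4, mul_one]; gcongr; linarith

theorem exists_abs_gaussPoly_le (p : ℝ[X]) :
    ∃ B : ℝ, 0 < B ∧ ∀ x : ℝ, |gaussPoly p x| ≤ B := by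
  obtain ⟨B, hB, h⟩ := exists_abs_exp_mul_eval_le (show (0 : ℝ) < 1 / 4 by norm_num) p
  refine ⟨B, hB, fun x => ?_⟩
  rw [gaussPoly, show -x ^ 2 / 4 = -(1 / 4) * x ^ 2 by ring]
  exact h x

theorem realHermite.coeff_two_mul_add (n k : ℕ) :
    (realHermite (2 * n + k)).coeff k =
      (-1) ^ n * (2 * n + k)! / ((k ! : ℝ) * (2 ^ n * (n ! : ℝ))) := by
  rw [realHermite, coeff_map, coeff_hermite_explicit]
  have h1 : ((2 * n)! : ℕ) = 2 ^ n * n ! * (2 * n - 1)‼ := by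
    cases n with
    | zero => simp
    | succ n =>
      rw [show 2 * (n + 1) = 2 * n + 1 + 1 by ring, Nat.factorial_eq_mul_doubleFactorial,
        show 2 * n + 1 + 1 = 2 * (n + 1) by ring, Nat.doubleFactorial_two_mul]
      rfl
  have h2 : Nat.choose (2 * n + k) k * k ! * (2 * n)! = (2 * n + k)! := by
    simpa using Nat.choose_mul_factorial_mul_factorial (Nat.le_add_left k (2 * n))
  have h3 : (k ! : ℝ) ≠ 0 := by exact_mod_cast k.factorial_ne_zero
  have h4 : (n ! : ℝ) ≠ 0 := by exact_mod_cast n.factorial_ne_zero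
  rw [← h2, h1]
  push_cast
  simp only [eq_intCast, Int.cast_mul, Int.cast_pow, Int.cast_neg, Int.cast_one, Int.cast_natCast]
  field_simp

theorem scaledHermite_eq_gaussPoly {γ : ℝ} (hγ : 0 ≤ γ) (m : ℕ) (x : ℝ) :
    scaledHermite γ m x = √2 ^ m * gaussPoly (realHermite m) (2 * √γ * x) := by
  have hexp : -(2 * √γ * x) ^ 2 / 4 = -γ * x ^ 2 := by
    rw [mul_pow, mul_pow, Real.sq_sqrt hγ]; ring
  rw [scaledHermite, gaussPoly, hexp, mul_left_comm]
  congr 1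
  rw [eval_eq_sum_range, realHermite.natDegree, Finset.mul_sum]
  -- The exponents 2l + m % 2 are those of the parity of m; all other coefficients of He_m vanish.
  refine Finset.sum_of_injOn (fun l => 2 * l + m % 2) ?_ ?_ ?_ ?_
  · intro a _ b _ hab
    simp only at hab
    lia
  · intro l hl
    simp only [Finset.coe_range, Set.mem_Iio] at hl ⊢
    lia
  · intro k hk hk'
    have hodd : Odd (m + k) := by
      by_contra heven
      rw [Nat.not_odd_iff_even, Nat.even_iff] at heven
      refine hk' ⟨k / 2, ?_, ?_⟩
      · simp only [Finset.mem_range, Finset.coe_range, Set.mem_Iio] at hk ⊢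
        lia
      · simp only
        lia
    rw [realHermite, coeff_map, coeff_hermite_of_odd_add hodd]
    simp
  · intro l hl
    rw [Finset.mem_range] at hl
    obtain ⟨n, hn⟩ : ∃ n, m / 2 = l + n := ⟨m / 2 - l, by lia⟩
    have hm : m = 2 * n + (2 * l + m % 2) := by lia
    have hn' : m / 2 - l = n := by lia
    rw [hermiteCoeff, hn']
    generalize hk : 2 * l + m % 2 = k at *
    subst hm
    rw [realHermite.coeff_two_mul_add, pow_add √2, pow_mul, Real.sq_sqrt (by norm_num),
      mul_pow, mul_pow, mul_pow]
    field_simp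

theorem exists_abs_scaledHermite_le (m : ℕ) {γ : ℝ} (hγ : 0 < γ) :
    ∃ C : ℝ, 0 < C ∧ ∀ x : ℝ, |scaledHermite γ m x| ≤ C * Real.exp (-γ * |x|) := by
  have hs : 0 < √γ := Real.sqrt_pos.mpr hγ
  -- Half of the Gaussian exponent 1/4 absorbs the polynomial; the other half gives the decay,
  -- through (|x| - 1)² ≥ 0.
  obtain ⟨B, hB, h⟩ := exists_abs_exp_mul_eval_le (show (0 : ℝ) < 1 / 8 by norm_num)
    (realHermite m)
  refine ⟨√2 ^ m * (B * Real.exp (γ / 2)), by positivity, fun x => ?_⟩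
  have h1 := h (2 * √γ * x)
  have h2 : (2 * √γ * x) ^ 2 = 4 * γ * x ^ 2 := by
    rw [mul_pow, mul_pow, Real.sq_sqrt hγ.le]; ring
  have h3 : Real.exp (-γ * x ^ 2) =
      Real.exp (-γ * x ^ 2 / 2) * Real.exp (-γ * x ^ 2 / 2) := by
    rw [← Real.exp_add]; ring_nf
  have h4 : Real.exp (-γ * x ^ 2 / 2) ≤ Real.exp (γ / 2) * Real.exp (-γ * |x|) := by
    rw [← Real.exp_add, Real.exp_le_exp, ← sq_abs]
    nlinarith [mul_nonneg hγ.le (sq_nonneg (|x| - 1))]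
  rw [scaledHermite_eq_gaussPoly hγ.le, gaussPoly, h2,
    show -(4 * γ * x ^ 2) / 4 = -γ * x ^ 2 by ring, h3, abs_mul, mul_assoc (Real.exp _), abs_mul,
    Real.abs_exp, abs_of_pos (show (0 : ℝ) < √2 ^ m by positivity), mul_assoc (√2 ^ m)]
  rw [h2, show -(1 / 8) * (4 * γ * x ^ 2) = -γ * x ^ 2 / 2 by ring] at h1
  refine mul_le_mul_of_nonneg_left ?_ (by positivity)
  calc _ ≤ Real.exp (γ / 2) * Real.exp (-γ * |x|) * B := by gcongr
    _ = _ := by ring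

theorem summable_exp_neg_mul_abs_int {c : ℝ} (hc : 0 < c) :
    Summable fun x : ℤ => Real.exp (-c * |(x : ℝ)|) := by
  have h : Summable fun n : ℕ => Real.exp (-c * (n : ℝ)) := by
    have := Real.summable_exp_nat_mul_iff.mpr (neg_neg_of_pos hc)
    simpa [mul_comm] using this
  refine Summable.of_nat_of_neg ?_ ?_ <;> simpa using h

theorem memℓp_two_scaledHermite_translate (m : ℕ) {γ : ℝ} (hγ : 0 < γ) (s : ℝ) :
    Memℓp (fun x : ℤ => ((scaledHermite γ m (x + s) : ℝ) : ℂ)) 2 := by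
  obtain ⟨C, hC, h⟩ := exists_abs_scaledHermite_le m hγ
  rw [memℓp_gen_iff (by norm_num)]
  refine Summable.of_nonneg_of_le (fun _ => by positivity) (fun x => ?_)
    ((summable_exp_neg_mul_abs_int (c := 2 * γ) (by positivity)).mul_left
      ((C * Real.exp (γ * |s|)) ^ 2))
  have h1 : |(x : ℝ)| ≤ |x + s| + |s| := by
    simpa using abs_sub (x + s : ℝ) s
  have h2 : |scaledHermite γ m (x + s)| ≤ C * Real.exp (γ * |s|) * Real.exp (-γ * |(x : ℝ)|) := by
    refine (h _).trans ?_
    rw [mul_assoc, ← Real.exp_add]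
    gcongr
    nlinarith
  have h3 : Real.exp (-(2 * γ) * |(x : ℝ)|) = Real.exp (-γ * |(x : ℝ)|) ^ 2 := by
    rw [← Real.exp_nat_mul]; push_cast; ring_nf
  rw [h3, ← mul_pow, Complex.norm_real, Real.norm_eq_abs, ENNReal.toReal_ofNat, Real.rpow_two]
  gcongr

/-! ### Taylor remainders and approximate eigenvectors -/

theorem abs_le_mul_pow_succ_of_abs_deriv_le {F F' : ℝ → ℝ} {K : ℝ} {n : ℕ} (hK : 0 ≤ K)
    (hF : ∀ t, HasDerivAt F (F' t) t) (h0 : F 0 = 0) (h : ∀ t, 0 ≤ t → |F' t| ≤ K * t ^ n)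
    (t : ℝ) (ht : 0 ≤ t) : |F t| ≤ K * t ^ (n + 1) := by
  have h1 := norm_image_sub_le_of_norm_deriv_le_segment' (f := F) (f' := F') (C := K * t ^ n)
    (a := 0) (b := t) (fun x _ => (hF x).hasDerivWithinAt)
    (fun x hx => (h x hx.1).trans (by have := hx.1; have := hx.2.le; gcongr)) t ⟨ht, le_rfl⟩
  rw [h0, sub_zero, sub_zero, Real.norm_eq_abs] at h1
  calc |F t| ≤ K * t ^ n * t := h1
    _ = _ := by ring

/-- The error of the second central difference quotient, in terms of a bound on the fourth
derivative. -/
theorem abs_second_difference_sub_le {g g₁ g₂ g₃ g₄ : ℝ → ℝ} {B : ℝ}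
    (h₁ : ∀ x, HasDerivAt g (g₁ x) x) (h₂ : ∀ x, HasDerivAt g₁ (g₂ x) x)
    (h₃ : ∀ x, HasDerivAt g₂ (g₃ x) x) (h₄ : ∀ x, HasDerivAt g₃ (g₄ x) x)
    (hB : ∀ x, |g₄ x| ≤ B) (y t : ℝ) (ht : 0 ≤ t) :
    |g (y + t) + g (y - t) - 2 * g y - t ^ 2 * g₂ y| ≤ 2 * B * t ^ 4 := by
  have hB0 : 0 ≤ 2 * B := by have := (abs_nonneg _).trans (hB 0); linarith
  have hp : ∀ {f f' : ℝ → ℝ}, (∀ x, HasDerivAt f (f' x) x) → ∀ s,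
      HasDerivAt (fun s => f (y + s)) (f' (y + s)) s := fun hf s =>
    (hf (y + s)).comp_const_add y s
  have hm : ∀ {f f' : ℝ → ℝ}, (∀ x, HasDerivAt f (f' x) x) → ∀ s,
      HasDerivAt (fun s => f (y - s)) (-f' (y - s)) s := fun hf s =>
    (hf (y - s)).comp_const_sub y s
  -- Each function bounded below vanishes at s = 0 and has the previous one as derivative, so four
  -- integrations give s⁴; the factors 1/n are dropped.
  have b4 : ∀ s, 0 ≤ s → |g₄ (y + s) + g₄ (y - s)| ≤ 2 * B * s ^ 0 := fun s _ => by
    have := (abs_add_le (g₄ (y + s)) (g₄ (y - s))).trans (add_le_add (hB _) (hB _))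
    linarith
  have b3 := abs_le_mul_pow_succ_of_abs_deriv_le (F := fun s => g₃ (y + s) - g₃ (y - s)) hB0
    (fun s => ((hp h₄ s).sub (hm h₄ s)).congr_deriv (by ring)) (by simp) b4
  have b2 := abs_le_mul_pow_succ_of_abs_deriv_le
    (F := fun s => g₂ (y + s) + g₂ (y - s) - 2 * g₂ y) hB0
    (fun s => (((hp h₃ s).add (hm h₃ s)).sub_const _).congr_deriv (by ring)) (by simp; ring) b3
  have b1 := abs_le_mul_pow_succ_of_abs_deriv_le
    (F := fun s => g₁ (y + s) - g₁ (y - s) - s * (2 * g₂ y)) hB0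
    (fun s => (((hp h₂ s).sub (hm h₂ s)).sub ((hasDerivAt_id s).mul_const _)).congr_deriv
      (by ring)) (by simp) b2
  exact abs_le_mul_pow_succ_of_abs_deriv_le
    (F := fun s => g (y + s) + g (y - s) - 2 * g y - s ^ 2 * g₂ y) hB0
    (fun s => ((((hp h₁ s).add (hm h₁ s)).sub_const _).sub
      ((hasDerivAt_pow 2 s).mul_const _)).congr_deriv (by simp; ring)) (by simp; ring) b1 t ht

theorem abs_two_mul_cos_sub_le (a : ℝ) : |2 * Real.cos a - 2 + a ^ 2| ≤ 2 * a ^ 4 := by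
  have h := abs_second_difference_sub_le (g := Real.cos) (g₁ := fun x => -Real.sin x)
    (g₂ := fun x => -Real.cos x) (g₃ := fun x => - -Real.sin x) (g₄ := fun x => - -Real.cos x)
    (B := 1) Real.hasDerivAt_cos (fun x => (Real.hasDerivAt_sin x).neg)
    (fun x => (Real.hasDerivAt_cos x).neg) (fun x => (Real.hasDerivAt_sin x).neg.neg)
    (fun x => by simpa using Real.abs_cos_le_one x) 0 |a| (abs_nonneg a)
  have h4 : |a| ^ 4 = a ^ 4 := by rw [← abs_pow]; exact abs_of_nonneg (by positivity)
  simp only [zero_add, zero_sub, Real.cos_neg, Real.cos_abs, Real.cos_zero, sq_abs, h4] at h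
  convert h using 2 <;> ring

theorem gaussPoly_realHermite_second_derivative (m : ℕ) (y : ℝ) :
    gaussPoly (gaussPolyDeriv (gaussPolyDeriv (realHermite m))) y =
      (y ^ 2 / 4 - m - 1 / 2) * gaussPoly (realHermite m) y := by
  have h := congrArg (eval y) (realHermite.differential_equation m)
  simp only [eval_sub, eval_mul, eval_X, eval_natCast] at h
  simp only [gaussPoly, gaussPolyDeriv, derivative_sub, derivative_mul, derivative_C,
    derivative_X, eval_sub, eval_mul, eval_C, eval_X, eval_add, eval_one, eval_zero, h]
  ring

/-- The relation between `a` and `X` is what remains of a = 2παX and γ = πα√β; it makes the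
quadratic part of the cosine cancel the y² term of the oscillator equation. -/
theorem exists_scaledHermite_approx_eigenvector (m : ℕ) :
    ∃ C : ℝ, 0 < C ∧ ∀ β γ a X : ℝ, 0 < β → 0 < γ → γ < 1 → β * a ^ 2 = 4 * γ ^ 2 * X ^ 2 →
      |scaledHermite γ m (X + 1) + scaledHermite γ m (X - 1) +
          2 * β * Real.cos a * scaledHermite γ m X -
          approxEigenvalue β γ m * scaledHermite γ m X| ≤ C * (1 + 1 / β) * γ ^ 2 := by
  set P := realHermite m with hP
  obtain ⟨B₀, hB₀, h₀⟩ := exists_abs_gaussPoly_le P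
  obtain ⟨B₁, hB₁, h₁⟩ := exists_abs_gaussPoly_le (X ^ 4 * P)
  obtain ⟨B₂, hB₂, h₂⟩ := exists_abs_gaussPoly_le
    (gaussPolyDeriv (gaussPolyDeriv (gaussPolyDeriv (gaussPolyDeriv P))))
  refine ⟨√2 ^ m * (32 * B₂ + 2 * B₁ + (2 + 4 * m) * B₀), by positivity, ?_⟩
  intro β γ a x hβ hγ hγ1 ha
  have hs : √γ ^ 2 = γ := Real.sq_sqrt hγ.le
  set t := 2 * √γ with ht
  have ht0 : 0 ≤ t := by positivity
  have ht2 : t ^ 2 = 4 * γ := by rw [ht, mul_pow, hs]; ring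
  set y := t * x with hy
  have hy2 : y ^ 2 = 4 * γ * x ^ 2 := by rw [hy, mul_pow, ht2]
  have hdiff := abs_second_difference_sub_le (hasDerivAt_gaussPoly P) (hasDerivAt_gaussPoly _)
    (hasDerivAt_gaussPoly _) (hasDerivAt_gaussPoly _) h₂ y t ht0
  rw [hP, gaussPoly_realHermite_second_derivative, ← hP] at hdiff
  -- The remainder is of size β a⁴ = γ² y⁴/β: this is the source of 1/β, and the Gaussian absorbs
  -- y⁴.
  have hcos : |β * (2 * Real.cos a - 2 + a ^ 2) * gaussPoly P y| ≤ 2 * B₁ * γ ^ 2 * (1 / β) := by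
    have h3 : |y ^ 4 * gaussPoly P y| ≤ B₁ := by
      have := h₁ y
      rw [gaussPoly, eval_mul, eval_pow, eval_X] at this
      rw [gaussPoly]
      convert this using 2
      ring
    have h4 : β * a ^ 4 = γ ^ 2 * y ^ 4 * (1 / β) := by
      rw [show y ^ 4 = (y ^ 2) ^ 2 by ring, hy2]
      field_simp
      linear_combination (β * a ^ 2 + 4 * γ ^ 2 * x ^ 2) * ha
    rw [abs_mul, abs_of_nonneg (by positivity : 0 ≤ y ^ 4)] at h3
    rw [abs_mul, abs_mul, abs_of_pos hβ]
    calc β * |2 * Real.cos a - 2 + a ^ 2| * |gaussPoly P y|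
        ≤ β * (2 * a ^ 4) * |gaussPoly P y| := by gcongr; exact abs_two_mul_cos_sub_le a
      _ = 2 * (β * a ^ 4) * |gaussPoly P y| := by ring
      _ = 2 * (γ ^ 2 * (1 / β)) * (y ^ 4 * |gaussPoly P y|) := by rw [h4]; ring
      _ ≤ 2 * (γ ^ 2 * (1 / β)) * B₁ := by gcongr
      _ = _ := by ring
  have hlam : |(2 * (1 - γ - Real.exp (-γ)) + 4 * m * γ * (Real.exp (-γ) - 1)) * gaussPoly P y| ≤
      (2 + 4 * m) * B₀ * γ ^ 2 := by
    have h3 : |1 - γ - Real.exp (-γ)| ≤ γ ^ 2 := by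
      have := Real.abs_exp_sub_one_sub_id_le (x := -γ) (by rw [abs_neg, abs_of_pos hγ]; exact hγ1.le)
      rw [neg_sq] at this
      rw [abs_sub_comm]
      convert this using 2
      ring
    have h4 : |Real.exp (-γ) - 1| ≤ γ := by
      rw [abs_le]
      constructor
      · linarith [Real.add_one_le_exp (-γ)]
      · linarith [Real.exp_le_one_iff.mpr (neg_nonpos.mpr hγ.le)]
    rw [abs_mul]
    calc _ ≤ (2 * γ ^ 2 + 4 * m * γ * γ) * B₀ := by
          refine mul_le_mul ((abs_add_le _ _).trans ?_) (h₀ y) (abs_nonneg _) (by positivity)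
          rw [abs_mul, abs_mul, abs_two, abs_of_nonneg (by positivity : 0 ≤ 4 * (m : ℝ) * γ)]
          gcongr
      _ = _ := by ring
  rw [scaledHermite_eq_gaussPoly hγ.le, scaledHermite_eq_gaussPoly hγ.le,
    scaledHermite_eq_gaussPoly hγ.le, ← hP, ← ht, ← hy, show t * (x + 1) = y + t by rw [hy]; ring,
    show t * (x - 1) = y - t by rw [hy]; ring]
  set G := gaussPoly P
  -- The three errors: central difference, cosine, and the linearisation of λ_m in γ.
  have hsplit : √2 ^ m * G (y + t) + √2 ^ m * G (y - t) + 2 * β * Real.cos a * (√2 ^ m * G y) -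
      approxEigenvalue β γ m * (√2 ^ m * G y) = √2 ^ m *
        ((G (y + t) + G (y - t) - 2 * G y - t ^ 2 * ((y ^ 2 / 4 - m - 1 / 2) * G y)) +
          β * (2 * Real.cos a - 2 + a ^ 2) * G y +
          (2 * (1 - γ - Real.exp (-γ)) + 4 * m * γ * (Real.exp (-γ) - 1)) * G y) := by
    rw [approxEigenvalue]
    linear_combination (√2 ^ m * G y) * ((y ^ 2 / 4 - m - 1 / 2) * ht2 - ha + γ * hy2)
  rw [hsplit, abs_mul, abs_of_pos (by positivity : (0 : ℝ) < √2 ^ m), mul_assoc (√2 ^ m),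
    mul_assoc (√2 ^ m)]
  refine mul_le_mul_of_nonneg_left ?_ (by positivity)
  have hb : 0 < 1 / β := by positivity
  have ht4 : t ^ 4 = 16 * γ ^ 2 := by rw [show t ^ 4 = (t ^ 2) ^ 2 by ring, ht2]; ring
  rw [ht4] at hdiff
  calc _ ≤ 2 * B₂ * (16 * γ ^ 2) + 2 * B₁ * γ ^ 2 * (1 / β) + (2 + 4 * m) * B₀ * γ ^ 2 :=
        (abs_add_three _ _ _).trans (by gcongr)
    _ = (32 * B₂ + 2 * B₁ * (1 / β) + (2 + 4 * m) * B₀) * γ ^ 2 := by ring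
    _ ≤ (32 * B₂ + 2 * B₁ * (1 / β) + (2 + 4 * m) * B₀) * γ ^ 2 +
          (32 * B₂ * (1 / β) + 2 * B₁ + (2 + 4 * m) * B₀ * (1 / β)) * γ ^ 2 :=
        le_add_of_nonneg_right (by positivity)
    _ = _ := by ring

theorem exists_almostMathieu_scaledHermite_sub_le (m : ℕ) :
    ∃ C : ℝ, 0 < C ∧ ∀ α β θ γ : ℝ, 0 < α → 0 < β → γ = Real.pi * α * √β → γ < 1 →
      ∃ h : Memℓp (fun x : ℤ =>
          ((scaledHermite γ m (x + θ / (2 * Real.pi * α)) : ℝ) : ℂ)) 2,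
        ∀ x : ℤ,
          ‖almostMathieu α β θ ⟨_, h⟩ x -
              ((approxEigenvalue β γ m : ℝ) : ℂ) *
                ((scaledHermite γ m (x + θ / (2 * Real.pi * α)) : ℝ) : ℂ)‖
            ≤ C * (1 + 1 / β) * γ ^ 2 := by
  obtain ⟨C, hC, h⟩ := exists_scaledHermite_approx_eigenvector m
  refine ⟨C, hC, fun α β θ γ hα hβ hγ hγ1 => ?_⟩
  have hπ := Real.pi_pos
  have hγ0 : 0 < γ := by rw [hγ]; positivity
  refine ⟨memℓp_two_scaledHermite_translate m hγ0 _, fun x => ?_⟩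
  set s := θ / (2 * Real.pi * α) with hs
  have hsθ : 2 * Real.pi * α * s = θ := by rw [hs]; field_simp
  have h1 := h β γ (2 * Real.pi * α * x + θ) (x + s) hβ hγ0 hγ1 (by
    rw [← hsθ, hγ, mul_pow (Real.pi * α), Real.sq_sqrt hβ.le]; ring)
  rw [← Real.norm_eq_abs, ← Complex.norm_real] at h1
  refine le_of_eq_of_le ?_ h1
  congr 1
  change almostMathieuFun α β θ _ x - _ = _
  simp only [almostMathieuFun]
  push_cast
  rw [show (x : ℝ) + 1 + s = x + s + 1 by ring, show (x : ℝ) - 1 + s = x + s - 1 by ring]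

/-! ### Sturm comparison and the spacing of Hermite zeros -/

/-- A form of the Sturm comparison theorem: a solution of `u'' = q u` with `-k² ≤ q` has no two
zeros at distance less than `π / k` with only positive values in between. -/
theorem sturm_separation {u u' q : ℝ → ℝ} {a b k : ℝ} (hk : 0 < k) (hab : a < b)
    (hlt : k * (b - a) < Real.pi) (hu : ∀ x, HasDerivAt u (u' x) x)
    (hu' : ∀ x, HasDerivAt u' (q x * u x) x) (hq : ∀ x, -k ^ 2 ≤ q x) (ha : u a = 0)
    (hb : u b = 0) (hpos : ∀ x ∈ Set.Ioo a b, 0 < u x) : False := by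
  set c := (a + b) / 2 with hc
  -- This solution of v'' = -k² v is positive on all of [a, b] because k(b - a) < π. Hence the
  -- Wronskian `W` is increasing and (u/v)' = W/v².
  set v : ℝ → ℝ := fun x => Real.cos (k * (x - c)) with hv
  set v' : ℝ → ℝ := fun x => -(k * Real.sin (k * (x - c))) with hv'
  have hlin : ∀ x, HasDerivAt (fun x => k * (x - c)) k x := fun x => by
    simpa using ((hasDerivAt_id x).sub_const c).const_mul k
  have dv : ∀ x, HasDerivAt v (v' x) x := fun x => (hlin x).cos.congr_deriv (by simp [hv']; ring)
  have dv' : ∀ x, HasDerivAt v' (-k ^ 2 * v x) x := fun x =>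
    ((hlin x).sin.const_mul k).neg.congr_deriv (by simp [hv]; ring)
  have vpos : ∀ x ∈ Set.Icc a b, 0 < v x := fun x hx =>
    Real.cos_pos_of_mem_Ioo ⟨by nlinarith [hx.1, hx.2], by nlinarith [hx.1, hx.2]⟩
  set W : ℝ → ℝ := fun x => u' x * v x - u x * v' x with hW
  have dW : ∀ x, HasDerivAt W ((q x + k ^ 2) * (u x * v x)) x := fun x =>
    (((hu' x).mul (dv x)).sub ((hu x).mul (dv' x))).congr_deriv (by ring)
  have hmono : MonotoneOn W (Set.Icc a b) := by
    refine monotoneOn_of_hasDerivWithinAt_nonneg (convex_Icc a b)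
      (fun x _ => (dW x).continuousAt.continuousWithinAt)
      (fun x _ => (dW x).hasDerivWithinAt) fun x hx => ?_
    rw [interior_Icc] at hx
    exact mul_nonneg (by linarith [hq x])
      (mul_pos (hpos x hx) (vpos x (Set.Ioo_subset_Icc_self hx))).le
  have dw : ∀ x ∈ Set.Icc a b, HasDerivAt (fun x => u x / v x) (W x / v x ^ 2) x := fun x hx =>
    (hu x).div (dv x) (vpos x hx).ne'
  have hac : a < c := by rw [hc]; linarith
  have hcb : c < b := by rw [hc]; linarith
  have hwc : 0 < u c / v c := div_pos (hpos c ⟨hac, hcb⟩) (vpos c ⟨hac.le, hcb.le⟩)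
  -- u/v rises from 0 and falls back to 0, so `W` is positive somewhere left of c and negative
  -- somewhere right of it, contradicting monotonicity.
  obtain ⟨x₁, hx₁, h₁⟩ := exists_hasDerivAt_eq_slope (fun x => u x / v x) (fun x => W x / v x ^ 2)
    hac (fun x hx => (dw x ⟨hx.1, hx.2.trans hcb.le⟩).continuousAt.continuousWithinAt)
    (fun x hx => dw x ⟨hx.1.le, hx.2.le.trans hcb.le⟩)
  obtain ⟨x₂, hx₂, h₂⟩ := exists_hasDerivAt_eq_slope (fun x => u x / v x) (fun x => W x / v x ^ 2)
    hcb (fun x hx => (dw x ⟨hac.le.trans hx.1, hx.2⟩).continuousAt.continuousWithinAt)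
    (fun x hx => dw x ⟨hac.le.trans hx.1.le, hx.2.le⟩)
  have m₁ : x₁ ∈ Set.Icc a b := ⟨hx₁.1.le, hx₁.2.le.trans hcb.le⟩
  have m₂ : x₂ ∈ Set.Icc a b := ⟨hac.le.trans hx₂.1.le, hx₂.2.le⟩
  simp only [ha, hb, zero_div, sub_zero, zero_sub] at h₁ h₂
  have hW₁ : 0 < W x₁ := by
    have h : 0 < W x₁ / v x₁ ^ 2 := h₁ ▸ div_pos hwc (by linarith)
    exact (div_pos_iff_of_pos_right (pow_pos (vpos _ m₁) 2)).mp h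
  have hW₂ : W x₂ < 0 := by
    have h : W x₂ / v x₂ ^ 2 < 0 := h₂ ▸ div_neg_of_neg_of_pos (neg_neg_of_pos hwc) (by linarith)
    by_contra! hcon
    exact absurd h (not_lt.mpr (div_nonneg hcon (sq_nonneg _)))
  linarith [hmono m₁ m₂ (hx₁.2.trans hx₂.1).le]

theorem Polynomial.pos_or_neg_on_Ioo {p : ℝ[X]} {a b : ℝ}
    (h : ∀ x ∈ Set.Ioo a b, p.eval x ≠ 0) :
    (∀ x ∈ Set.Ioo a b, 0 < p.eval x) ∨ ∀ x ∈ Set.Ioo a b, p.eval x < 0 := by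
  by_contra! hcon
  obtain ⟨⟨x, hx, hx0⟩, y, hy, hy0⟩ := hcon
  obtain ⟨z, hz, hz0⟩ := isPreconnected_Ioo.intermediate_value hx hy
    (p.continuous.continuousOn) ⟨hx0, hy0⟩
  exact h z hz hz0

/-- Two consecutive zeros of a Hermite polynomial are at distance at least `π / √(m + 1/2)`. -/
theorem realHermite.pi_le_of_consecutive_roots {m : ℕ} {a b : ℝ} (hab : a < b)
    (ha : (realHermite m).eval a = 0) (hb : (realHermite m).eval b = 0)
    (h : ∀ x ∈ Set.Ioo a b, (realHermite m).eval x ≠ 0) :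
    Real.pi ≤ √(m + 1 / 2) * (b - a) := by
  by_contra! hlt
  have hk : 0 < √((m : ℝ) + 1 / 2) := Real.sqrt_pos.mpr (by positivity)
  have hsq : √((m : ℝ) + 1 / 2) ^ 2 = m + 1 / 2 := Real.sq_sqrt (by positivity)
  set P := realHermite m with hP
  have d1 := hasDerivAt_gaussPoly P
  have d2 : ∀ x, HasDerivAt (gaussPoly (gaussPolyDeriv P))
      ((x ^ 2 / 4 - m - 1 / 2) * gaussPoly P x) x := fun x =>
    (hasDerivAt_gaussPoly _ x).congr_deriv (gaussPoly_realHermite_second_derivative m x)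
  have hq : ∀ x : ℝ, -√((m : ℝ) + 1 / 2) ^ 2 ≤ x ^ 2 / 4 - m - 1 / 2 := fun x => by
    rw [hsq]; linarith [sq_nonneg x]
  have ga : gaussPoly P a = 0 := by rw [gaussPoly, ha, mul_zero]
  have gb : gaussPoly P b = 0 := by rw [gaussPoly, hb, mul_zero]
  rcases pos_or_neg_on_Ioo h with hs | hs
  · exact sturm_separation hk hab hlt d1 d2 hq ga gb fun x hx =>
      mul_pos (Real.exp_pos _) (hs x hx)
  · refine sturm_separation hk hab hlt (u := fun x => -gaussPoly P x) (fun x => (d1 x).neg)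
      (fun x => (d2 x).neg.congr_deriv (by ring)) hq (by simp [ga]) (by simp [gb]) fun x hx => ?_
    exact neg_pos.mpr (mul_neg_of_pos_of_neg (Real.exp_pos _) (hs x hx))

/-! ### Counting sign changes on a lattice -/

theorem Polynomial.exists_eval_eq_zero_of_mul_neg {p : ℝ[X]} {a b : ℝ} (hab : a < b)
    (h : p.eval a * p.eval b < 0) : ∃ t ∈ Set.Ioo a b, p.eval t = 0 := by
  by_contra! hcon
  have hc := p.continuous.continuousOn (s := Set.Icc a b)
  rcases mul_neg_iff.mp h with ⟨h1, h2⟩ | ⟨h1, h2⟩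
  · obtain ⟨t, ht, h0⟩ := intermediate_value_Ioo' hab.le hc ⟨h2, h1⟩
    exact hcon t ht h0
  · obtain ⟨t, ht, h0⟩ := intermediate_value_Ioo hab.le hc ⟨h1, h2⟩
    exact hcon t ht h0

/-- Write p = (X - t) q. Simplicity gives q(t) ≠ 0, so q has no zero on [a, b] and keeps its sign.
-/
theorem Polynomial.eval_mul_eval_neg_of_unique_simple_root {p : ℝ[X]} {a b t : ℝ}
    (hat : a < t) (htb : t < b) (ht : p.eval t = 0) (ht' : (derivative p).eval t ≠ 0)
    (h : ∀ x ∈ Set.Icc a b, p.eval x = 0 → x = t) : p.eval a * p.eval b < 0 := by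
  obtain ⟨q, hq⟩ := dvd_iff_isRoot.mpr ht
  have hqt : q.eval t ≠ 0 := by
    rw [hq] at ht'
    simpa [derivative_mul] using ht'
  have hq0 : ∀ x ∈ Set.Icc a b, q.eval x ≠ 0 := fun x hx h0 => by
    have hx' := h x hx (by rw [hq, eval_mul, h0, mul_zero])
    exact hqt (hx' ▸ h0)
  have hqab : 0 < q.eval a * q.eval b := by
    have hab := hat.trans htb
    have ha := hq0 a ⟨le_rfl, hab.le⟩
    have hb := hq0 b ⟨hab.le, le_rfl⟩
    by_contra! hcon
    obtain ⟨z, hz, h0⟩ := exists_eval_eq_zero_of_mul_neg hab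
      (lt_of_le_of_ne hcon (mul_ne_zero ha hb))
    exact hq0 z (Set.Ioo_subset_Icc_self hz) h0
  have : p.eval a * p.eval b = ((a - t) * (b - t)) * (q.eval a * q.eval b) := by
    rw [hq]; simp only [eval_mul, eval_sub, eval_X, eval_C]; ring
  rw [this]
  exact mul_neg_of_neg_of_pos (mul_neg_of_neg_of_pos (by linarith) (by linarith)) hqab

/-- If consecutive zeros of `p` are at distance more than `s` then between any two zeros there is
a point of `sℤ`. -/
theorem Polynomial.exists_int_between_roots {p : ℝ[X]} (hp : p ≠ 0) {s : ℝ} (hs : 0 < s)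
    (hgap : ∀ a b, a < b → p.eval a = 0 → p.eval b = 0 →
      (∀ x ∈ Set.Ioo a b, p.eval x ≠ 0) → s < b - a)
    {a b : ℝ} (hab : a < b) (ha : p.eval a = 0) (hb : p.eval b = 0) :
    ∃ k : ℤ, a < s * k ∧ s * k < b := by
  have hne : (p.roots.toFinset.filter fun x => a < x).Nonempty :=
    ⟨b, by simp [hp, hb, hab]⟩
  obtain ⟨c, hc, hmin⟩ := Finset.exists_min_image _ id hne
  simp only [Finset.mem_filter, Multiset.mem_toFinset, mem_roots hp, IsRoot.def, id] at hc hmin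
  have hcb : c ≤ b := hmin b ⟨hb, hab⟩
  -- c is the next root after a, so the first lattice point beyond a, which is at most a + s, lies
  -- before c.
  have h := hgap a c hc.2 ha hc.1 fun x hx h0 => absurd (hmin x ⟨h0, hx.1⟩) (not_le.mpr hx.2)
  refine ⟨⌊a / s⌋ + 1, ?_, ?_⟩
  · have := Int.lt_floor_add_one (a / s)
    rw [div_lt_iff₀ hs] at this
    push_cast
    linarith
  · have := Int.floor_le (a / s)
    rw [le_div_iff₀ hs] at this
    push_cast
    linarith

/-- A polynomial with simple real zeros that are more than `s` apart, times a positive weight, has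
as many sign changes on `sℤ` as it has real zeros. -/
theorem signChanges_eq_card_roots {p : ℝ[X]} (hp : p ≠ 0)
    (hsimple : ∀ t, p.eval t = 0 → (derivative p).eval t ≠ 0) {s : ℝ} (hs : 0 < s)
    (hgap : ∀ a b, a < b → p.eval a = 0 → p.eval b = 0 →
      (∀ x ∈ Set.Ioo a b, p.eval x ≠ 0) → s < b - a)
    {f w : ℤ → ℝ} (hw : ∀ i, 0 < w i) (hf : ∀ i, f i = w i * p.eval (s * i)) :
    signChanges f = p.roots.toFinset.card := by
  have hbetween := @exists_int_between_roots p hp s hs hgap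
  have hf0 : ∀ i, f i = 0 ↔ p.eval (s * i) = 0 := fun i => by simp [hf, (hw i).ne']
  have hfneg : ∀ i j, f i * f j < 0 ↔ p.eval (s * i) * p.eval (s * j) < 0 := fun i j => by
    rw [hf, hf, mul_mul_mul_comm]
    exact smul_neg_iff_of_pos_left (mul_pos (hw i) (hw j))
  -- `L t` and `R t` index the lattice points strictly next to t. If t itself is a lattice point, it
  -- lies between them and carries a zero entry.
  obtain ⟨L, hL⟩ : ∃ L : ℝ → ℤ, ∀ t k, k ≤ L t ↔ s * k < t := ⟨fun t => ⌈t / s⌉ - 1, fun t k => by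
    rw [Int.le_sub_one_iff, Int.lt_ceil, lt_div_iff₀ hs, mul_comm]⟩
  obtain ⟨R, hR⟩ : ∃ R : ℝ → ℤ, ∀ t k, R t ≤ k ↔ t < s * k := ⟨fun t => ⌊t / s⌋ + 1, fun t k => by
    rw [Int.add_one_le_iff, Int.floor_lt, div_lt_iff₀ hs, mul_comm]⟩
  have hL' : ∀ t, s * L t < t := fun t => (hL t _).mp le_rfl
  have hR' : ∀ t, t < s * R t := fun t => (hR t _).mp le_rfl
  have hLR : ∀ t, L t < R t := fun t => by
    have := (hL' t).trans (hR' t)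
    exact_mod_cast lt_of_mul_lt_mul_left this hs.le
  have hleft : ∀ t x, p.eval t = 0 → p.eval x = 0 → x < t → x < s * L t := fun t x ht hx hxt => by
    obtain ⟨k, hk1, hk2⟩ := hbetween hxt hx ht
    have : (k : ℝ) ≤ L t := by exact_mod_cast (hL t k).mpr hk2
    exact hk1.trans_le (by gcongr)
  have hright : ∀ t x, p.eval t = 0 → p.eval x = 0 → t < x → s * R t < x :=
    fun t x ht hx htx => by
      obtain ⟨k, hk1, hk2⟩ := hbetween htx ht hx
      have : (R t : ℝ) ≤ k := by exact_mod_cast (hR t k).mpr hk1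
      exact lt_of_le_of_lt (by gcongr) hk2
  have hset : {q : ℤ × ℤ | q.1 < q.2 ∧ f q.1 * f q.2 < 0 ∧
      ∀ k : ℤ, q.1 < k → k < q.2 → f k = 0} =
        (fun t => (L t, R t)) '' (p.roots.toFinset : Set ℝ) := by
    ext ⟨i, j⟩
    simp only [Set.mem_ofPred_eq, Set.mem_image, Finset.mem_coe, Multiset.mem_toFinset,
      mem_roots hp, IsRoot.def, Prod.mk.injEq, hfneg]
    constructor
    · rintro ⟨hij, hneg, hz⟩
      have hij' : s * i < s * j := by gcongr
      obtain ⟨t, ⟨hit, htj⟩, ht⟩ := exists_eval_eq_zero_of_mul_neg hij' hneg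
      have hi := (hL t i).mpr hit
      have hj := (hR t j).mpr htj
      have hLt := hLR t
      refine ⟨t, ht, ?_, ?_⟩
      · by_contra hne
        have h0 := (hf0 _).mp (hz (L t) (lt_of_le_of_ne hi (Ne.symm hne)) (hLt.trans_le hj))
        exact lt_irrefl _ (hleft t _ ht h0 (hL' t))
      · by_contra hne
        have h0 := (hf0 _).mp (hz (R t) (hi.trans_lt hLt) (lt_of_le_of_ne hj hne))
        exact lt_irrefl _ (hright t _ ht h0 (hR' t))
    · rintro ⟨t, ht, rfl, rfl⟩
      refine ⟨hLR t, ?_, fun k hk1 hk2 => ?_⟩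
      · refine eval_mul_eval_neg_of_unique_simple_root (hL' t) (hR' t) ht (hsimple t ht)
          fun x hx h0 => ?_
        rcases lt_trichotomy x t with h | h | h
        · exact absurd (hleft t x ht h0 h) (not_lt.mpr hx.1)
        · exact h
        · exact absurd (hright t x ht h0 h) (not_lt.mpr hx.2)
      · rw [← not_le, hL] at hk1
        rw [← not_le, hR] at hk2
        rw [hf0, le_antisymm (not_lt.mp hk2) (not_lt.mp hk1), ht]
  have hinj : Set.InjOn (fun t => (L t, R t)) (p.roots.toFinset : Set ℝ) := by
    intro t ht t' ht' h
    simp only [Finset.mem_coe, Multiset.mem_toFinset, mem_roots hp, IsRoot.def] at ht ht'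
    simp only [Prod.mk.injEq] at h
    rcases lt_trichotomy t t' with hlt | hlt | hlt
    · have := hleft t' t ht' ht hlt
      rw [← h.1] at this
      exact absurd this (not_lt.mpr (hL' t).le)
    · exact hlt
    · have := hleft t t' ht ht' hlt
      rw [h.1] at this
      exact absurd this (not_lt.mpr (hL' t').le)
  rw [signChanges, hset, hinj.encard_image, Set.encard_coe_eq_coe_finsetCard]

/-- The hypothesis on m is (m + 1/2) · 4γ < π², that is, mesh 2√γ below the zero spacing π/√(m +
1/2). -/
theorem signChanges_scaledHermite {m : ℕ} {γ : ℝ} (hγ : 0 < γ)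
    (hm : (m : ℝ) < Real.pi ^ 2 / (4 * γ) - 1 / 2) :
    signChanges (fun i : ℤ => scaledHermite γ m i) = m := by
  have hs : 0 < 2 * √γ := by positivity
  have hs2 : (2 * √γ) ^ 2 = 4 * γ := by rw [mul_pow, Real.sq_sqrt hγ.le]; norm_num
  have hcard := realHermite.card_roots_toFinset m
  conv_rhs => rw [← hcard]
  refine signChanges_eq_card_roots (realHermite.monic m).ne_zero
    (realHermite.eval_derivative_ne_zero m) hs (fun a b hab ha hb h => ?_)
    (w := fun i => √2 ^ m * Real.exp (-(2 * √γ * i) ^ 2 / 4)) (fun i => by positivity) fun i => ?_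
  · have h1 := realHermite.pi_le_of_consecutive_roots hab ha hb h
    have hk2 : √((m : ℝ) + 1 / 2) ^ 2 = m + 1 / 2 := Real.sq_sqrt (by positivity)
    have h2 : √((m : ℝ) + 1 / 2) * (2 * √γ) < Real.pi := by
      refine lt_of_pow_lt_pow_left₀ 2 Real.pi_pos.le ?_
      rw [mul_pow, hk2, hs2, ← lt_div_iff₀ (by positivity)]
      linarith
    exact lt_of_mul_lt_mul_left (h2.trans_le h1) (Real.sqrt_nonneg _)
  · rw [scaledHermite_eq_gaussPoly hγ.le, gaussPoly, mul_assoc (√2 ^ m)]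

theorem theorem3p1 :
    -- approximate eigenvectors, with error of order `γ ^ 2` at every site
    (∀ N : ℕ, ∃ C : ℝ, 0 < C ∧
      ∀ m : ℕ, m ≤ N → ∀ α β θ γ : ℝ, 0 < α → 0 < β → θ ∈ Set.Ico 0 (2 * Real.pi) →
        γ = Real.pi * α * √β → γ < 1 →
          ∃ h : Memℓp (fun x : ℤ =>
              ((scaledHermite γ m (x + θ / (2 * Real.pi * α)) : ℝ) : ℂ)) 2,
            ∀ x : ℤ,
              ‖almostMathieu α β θ ⟨_, h⟩ x -
                  ((approxEigenvalue β γ m : ℝ) : ℂ) *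
                    ((scaledHermite γ m (x + θ / (2 * Real.pi * α)) : ℝ) : ℂ)‖
                ≤ C * (1 + 1 / β) * γ ^ 2) ∧
    -- exponential decay
    (∀ (m : ℕ) (γ : ℝ), 0 < γ → γ < 1 →
      ∃ C₁ C₂ : ℝ, 0 < C₁ ∧ 0 < C₂ ∧
        ∀ i : ℤ, |scaledHermite γ m i| ≤ C₁ * Real.exp (-C₂ * |(i : ℝ)|)) ∧
    -- number of sign changes
    (∀ (m : ℕ) (γ : ℝ), 0 < γ → γ < 1 → (m : ℝ) < Real.pi ^ 2 / (4 * γ) - 1 / 2 →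
      signChanges (fun i : ℤ => scaledHermite γ m i) = m) := by
  refine ⟨fun N => ?_, fun m γ hγ _ => ?_, fun m γ hγ _ hm => signChanges_scaledHermite hγ hm⟩
  · choose C hC h using exists_almostMathieu_scaledHermite_sub_le
    refine ⟨∑ m ∈ Finset.range (N + 1), C m,
      Finset.sum_pos (fun m _ => hC m) (by simp), fun m hm α β θ γ hα hβ _ hγ hγ1 => ?_⟩
    obtain ⟨hmem, hle⟩ := h m α β θ γ hα hβ hγ hγ1
    refine ⟨hmem, fun x => (hle x).trans ?_⟩
    have hCm : C m ≤ ∑ m ∈ Finset.range (N + 1), C m :=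
      Finset.single_le_sum (fun m _ => (hC m).le) (Finset.mem_range.mpr (by lia))
    gcongr
  · obtain ⟨C, hC, h⟩ := exists_abs_scaledHermite_le m hγ
    exact ⟨C, γ, hC, hγ, fun i => h i⟩
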